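/- Let $q$ be a power of a prime and let $\mathcal H$ be the set of affine $\mathbb F_{q^2}$-points $(x,y)\in\mathbb F_{q^2}^2$ of the Hermitian curve $x^{q+1}=y^q+y$. A parabola is a curve $y=ax^2+bx+c$ with $a,b,c\in\mathbb F_{q^2}$ and $a\neq 0$. For a parabola $C$, its planar intersection with $\mathcal H$ is the number of points $(x,y)\in\mathbb F_{q^2}^2$ lying on both $\mathcal H$ and $C$, counted without multiplicity. For an integer $k\ge 0$ let $n_k$ be the number of parabolas whose planar intersection with $\mathcal H$ equals $k$. (1) If $q$ is odd, the planar intersection of $\mathcal H$ with any parabola lies in $\{0,1,q-1,q,q+1,2q-1,2q\}$, and $$n_0=q^2(q+1)\frac{q-1}{2},\qquad n_1=q^2(q+1)\frac{q(q-3)}{2},\qquad n_{q-1}=q^2(q+1)\frac{q(q-1)^2}{2},$$ $$n_q=q^2(q+1)(q^2-q+1),\qquad n_{q+1}=q^2(q+1)\frac{q(q-1)(q-3)}{2},$$ $$n_{2q-1}=q^2(q+1)\frac{q(q-1)}{2},\qquad n_{2q}=q^2(q+1)\frac{q-1}{2}.$$ (2) If $q$ is even, the planar intersection of $\mathcal H$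 with any parabola lies in $\{1,q-1,q+1,2q-1\}$. If moreover $q\neq 2$, then $$n_1=q^3(q+1)\left(\frac q2-1\right),\qquad n_{q-1}=q^3(q+1)(q-1)\frac q2,$$ $$n_{q+1}=q^3(q+1)(q-1)\left(\frac q2-1\right),\qquad n_{2q-1}=q^3(q+1)\frac q2.$$ If $q=2$, where $q-1=1$ and $2q-1=q+1=3$, then $n_1=n_3=24$. -/

import Mathlib

/-- The affine `F`-points of the Hermitian curve `x^(q+1) = y^q + y`. -/
def hermitianCurve (q : ℕ) (F : Type*) [Field F] : Set (F × F) :=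
  {P | P.1 ^ (q + 1) = P.2 ^ q + P.2}

/-- The affine `F`-points of the curve `y = a x^2 + b x + c`. -/
def parabola {F : Type*} [Field F] (a b c : F) : Set (F × F) :=
  {P | P.2 = a * P.1 ^ 2 + b * P.1 + c}

/-- A plane curve is a parabola if it is `y = a x^2 + b x + c` for some `a ≠ 0`, `b`, `c`. -/
def IsParabola {F : Type*} [Field F] (C : Set (F × F)) : Prop :=
  ∃ a b c : F, a ≠ 0 ∧ C = parabola a b c

/-- The number of affine points that lie on both curves, disregarding multiplicity. -/
noncomputable def planarIntersection {F : Type*} (X Y : Set (F × F)) : ℕ :=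
  (X ∩ Y).ncard

/-- The number of parabolas that meet the Hermitian curve in exactly `k` affine `F`-points. -/
noncomputable def numParabolas (q : ℕ) (F : Type*) [Field F] (k : ℕ) : ℕ :=
  {C : Set (F × F) | IsParabola C ∧ planarIntersection (hermitianCurve q F) C = k}.ncard

/-!
Eliminating `y`, the common points of the Hermitian curve and `y = a x² + b x + c` correspond to the
solutions in `F` of `N(x) - Tr(a x²) - Tr(b x) = Tr(c)`, where `N` and `Tr` are the norm and trace
to the subfield with `q` elements. So one counts the points of the level sets of the binary
quadratic form `Q(x) = N(x) - Tr(a x²)`.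

* If `N(2a) ≠ 1`, then `Q` is nondegenerate and completing the square removes `b`. If `Q(x) = 0` has
  a nonzero solution, then `Q` is a product of two independent linear forms; so `Q` has `1` or
  `2q - 1` zeros. Since the number of pairs with `Q(x) = Q(y)` is known, the other level sets must
  all have the same size.
* If `N(2a) = 1`, then `Q(x)` is a constant times the square of `x^q - 2 a x`, a map whose fibres
  have `q` elements. Either `b` can be removed again, or `x^q - 2 a x` is injective on every level
  set, and then all of them have `q` elements.

Finally, the numbers of `a` with `1` and with `2q - 1` zeros follow by counting the pairs `(a, x)`
with `x ≠ 0` and `Q(x) = 0`: for given `x`, this is one trace equation on `a`.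
-/

open Finset

section FiberCounting

variable {α β : Type*}

theorem card_fiber_eq_of_card_fiber_le [DecidableEq β] {S : Finset α} {T : Finset β} {f : α → β}
    {m : ℕ} (hf : Set.MapsTo f S T) (hle : ∀ t ∈ T, #{x ∈ S | f x = t} ≤ m)
    (hcard : #T * m ≤ #S) : ∀ t ∈ T, #{x ∈ S | f x = t} = m := by
  refine (sum_eq_sum_iff_of_le hle).1 (le_antisymm (sum_le_sum hle) ?_)
  rwa [← card_eq_sum_card_fiberwise hf, sum_const, smul_eq_mul]

theorem sum_sq_card_fiber [Fintype α] [DecidableEq β] {T : Finset β} {f : α → β}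
    (hf : ∀ x, f x ∈ T) : ∑ t ∈ T, #{x | f x = t} ^ 2 = ∑ x, #{y | f y = f x} := by
  rw [← sum_fiberwise_of_maps_to (fun x _ ↦ hf x)]
  refine sum_congr rfl fun t _ ↦ ?_
  rw [sum_congr rfl fun x hx ↦ by rw [(mem_filter.1 hx).2], sum_const, smul_eq_mul, sq]

theorem eq_of_sum_eq_of_sum_sq_eq {R : Type*} [CommRing R] [LinearOrder R] [IsStrictOrderedRing R]
    {T : Finset α} {M : α → R} {m : R} (hsum : ∑ t ∈ T, M t = #T * m)
    (hsq : ∑ t ∈ T, M t ^ 2 = #T * m ^ 2) : ∀ t ∈ T, M t = m := by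
  have hvar : ∑ t ∈ T, (M t - m) ^ 2 = 0 := by
    simp only [sub_sq, sum_add_distrib, sum_sub_distrib, ← sum_mul, ← mul_sum, hsum, hsq,
      sum_const, nsmul_eq_mul]
    ring
  exact fun t ht ↦ sub_eq_zero.1 <| pow_eq_zero_iff two_ne_zero |>.1 <|
    (sum_eq_zero_iff_of_nonneg fun _ _ ↦ sq_nonneg _).1 hvar t ht

theorem card_filter_eq_of_eq_zero_or_eq {T : Finset α} {M : α → ℕ} {n : ℕ} (hn : n ≠ 0)
    (hM : ∀ t ∈ T, M t = 0 ∨ M t = n) (k : ℕ) :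
    (#{t ∈ T | M t = k} : ℚ) = (if k = 0 then #T - (∑ t ∈ T, M t : ℚ) / n else 0) +
      if k = n then (∑ t ∈ T, M t : ℚ) / n else 0 := by
  have hn' : (n : ℚ) ≠ 0 := Nat.cast_ne_zero.2 hn
  have hpoint : ∀ t ∈ T, (if M t = k then 1 else 0 : ℚ) =
      (if k = 0 then 1 - (M t : ℚ) / n else 0) + if k = n then (M t : ℚ) / n else 0 := by
    intro t ht
    obtain h | h := hM t ht <;> simp [h, hn', eq_comm]
  rw [card_filter, Nat.cast_sum]
  push_cast
  rw [sum_congr rfl hpoint, sum_add_distrib]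
  split_ifs <;> simp [sum_div]

theorem card_filter_pow_sub_mul_eq_le {R : Type*} [CommRing R] [IsDomain R] [Fintype R]
    [DecidableEq R] {n : ℕ} (hn : 2 ≤ n) (u z : R) : #{x : R | x ^ n - u * x = z} ≤ n := by
  let p : Polynomial R := .X ^ n - (.C u * .X + .C z)
  have hdeg : p.natDegree = n := by
    rw [Polynomial.natDegree_sub_eq_left_of_natDegree_lt, Polynomial.natDegree_X_pow]
    exact Polynomial.natDegree_linear_le.trans_lt (by rwa [Polynomial.natDegree_X_pow])
  have hp : p ≠ 0 := by
    rintro h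
    simp only [h, Polynomial.natDegree_zero] at hdeg
    omega
  refine (Polynomial.card_le_degree_of_subset_roots fun x hx ↦ ?_).trans_eq hdeg
  have hx' : x ^ n - u * x = z := (mem_filter.1 hx).2
  refine (Polynomial.mem_roots hp).2 ?_
  simp [p, ← hx']

end FiberCounting

/-- `σ` is the conjugation `x ↦ x ^ q` of a field with `q ^ 2` elements over its subfield with `q`
elements. That subfield is always written as `{x | σ x = x}`, and the norm and trace to it as
`x * σ x` and `x + σ x`. -/
structure IsQuadraticConj (q : ℕ) {F : Type*} [Field F] [Fintype F] (σ : F →+* F) : Prop where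
  card_eq : Fintype.card F = q ^ 2
  apply_eq_pow : ∀ x, σ x = x ^ q

theorem exists_isQuadraticConj {q : ℕ} (hq : IsPrimePow q) {F : Type*} [Field F] [Fintype F]
    (hF : Fintype.card F = q ^ 2) : ∃ σ : F →+* F, IsQuadraticConj q σ := by
  obtain ⟨p, n, hp, -, rfl⟩ := hq
  have : Fact p.Prime := ⟨hp.nat_prime⟩
  have : CharP F p := charP_of_card_eq_prime_pow (hF.trans (pow_mul p n 2).symm)
  exact ⟨iterateFrobenius F p n, hF, iterateFrobenius_def p n⟩

namespace IsQuadraticConj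

variable {q : ℕ} {F : Type*} [Field F] [Fintype F] {σ : F →+* F}

theorem two_le (hσ : IsQuadraticConj q σ) : 2 ≤ q := by
  have := hσ.card_eq ▸ Fintype.one_lt_card (α := F)
  by_contra! h
  interval_cases q <;> simp at this

theorem two_eq_zero_iff (hσ : IsQuadraticConj q σ) : (2 : F) = 0 ↔ Even q := by
  have hchar : ringChar F = 2 ↔ Even q := by
    rw [FiniteField.even_card_iff_char_two, hσ.card_eq, ← Nat.even_iff, Nat.even_pow' two_ne_zero]
  rw [← hchar]
  exact ⟨not_imp_not.1 Ring.two_ne_zero, fun h ↦ mod_cast (ringChar.spec F 2).2 h.dvd⟩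

theorem apply_apply (hσ : IsQuadraticConj q σ) (x : F) : σ (σ x) = x := by
  rw [hσ.apply_eq_pow, hσ.apply_eq_pow, ← pow_mul, ← sq, ← hσ.card_eq, FiniteField.pow_card]

variable [DecidableEq F]

/-- Both the kernel and, as it lies in a kernel of the same shape, the range of the additive map
`x ↦ σ x - u * x` have at most `q` elements; there being `q ^ 2` points, equality holds. -/
theorem card_filter_sub_mul_eq (hσ : IsQuadraticConj q σ) {u z : F} (hu : u * σ u = 1)
    (hz : σ z = -σ u * z) : #{x | σ x - u * x = z} = q := by
  have hle (v t : F) : #{x | σ x - v * x = t} ≤ q := by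
    simpa only [hσ.apply_eq_pow] using card_filter_pow_sub_mul_eq_le hσ.two_le v t
  refine card_fiber_eq_of_card_fiber_le (S := univ) (T := {t | σ t - -σ u * t = 0})
    (fun x _ ↦ ?_) (fun t _ ↦ hle u t) ?_ z (by simp [hz])
  · simp only [coe_filter, mem_univ, true_and, Set.mem_ofPred_eq, map_sub, map_mul,
      hσ.apply_apply]
    linear_combination (-x) * hu
  · rw [card_univ, hσ.card_eq, sq]
    exact Nat.mul_le_mul_right q (hle _ 0)

theorem card_filter_eq_mul (hσ : IsQuadraticConj q σ) {u : F} (hu : u * σ u = 1) :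
    #{x | σ x = u * x} = q := by
  simpa only [sub_eq_zero] using hσ.card_filter_sub_mul_eq (z := 0) hu (by simp)

theorem card_filter_eq_mul_or_eq_mul (hσ : IsQuadraticConj q σ) {u v : F} (hu : u * σ u = 1)
    (hv : v * σ v = 1) (huv : u ≠ v) : #{x | σ x = u * x ∨ σ x = v * x} = 2 * q - 1 := by
  have hinter : ({x | σ x = u * x ∧ σ x = v * x} : Finset F) = {0} := by
    ext x
    simp only [mem_filter_univ, mem_singleton]
    refine ⟨fun ⟨hx, hx'⟩ ↦ ?_, fun h ↦ by simp [h]⟩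
    by_contra hx0
    exact huv (mul_right_cancel₀ hx0 (hx.symm.trans hx'))
  rw [filter_or, card_union, ← filter_and, hinter, card_singleton, hσ.card_filter_eq_mul hu,
    hσ.card_filter_eq_mul hv, two_mul]

theorem card_fixed (hσ : IsQuadraticConj q σ) : #{x | σ x = x} = q := by
  simpa only [one_mul] using hσ.card_filter_eq_mul (u := 1) (by simp)

theorem card_fixed_erase_zero (hσ : IsQuadraticConj q σ) :
    #(({x | σ x = x} : Finset F).erase 0) = q - 1 := by
  rw [card_erase_of_mem (by simp), hσ.card_fixed]

theorem card_trace_mul_eq (hσ : IsQuadraticConj q σ) {w t : F} (hw : w ≠ 0) (ht : σ t = t) :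
    #{x | x * w + σ (x * w) = t} = q := by
  rw [card_equiv (t := {y | σ y - -1 * y = t}) (Equiv.mulRight₀ w hw) (by simp [add_comm])]
  exact hσ.card_filter_sub_mul_eq (by simp) (by simpa using ht)

theorem card_norm_eq_one (hσ : IsQuadraticConj q σ) : #{u | u * σ u = 1} = q + 1 := by
  have hmaps : Set.MapsTo (fun x ↦ σ x / x) (univ.erase 0 : Finset F)
      ({u | u * σ u = 1} : Finset F) := by
    intro x hx
    have hx0 : x ≠ 0 := by simpa using hx
    have hσx : σ x ≠ 0 := (map_ne_zero σ).2 hx0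
    simp [map_div₀, hσ.apply_apply, hx0, hσx]
  have hfib : ∀ u ∈ ({u | u * σ u = 1} : Finset F),
      #{x ∈ univ.erase 0 | σ x / x = u} = q - 1 := by
    intro u hu
    rw [← hσ.card_filter_eq_mul (by simpa using hu), ← card_erase_of_mem (a := 0) (by simp)]
    congr 1
    ext x
    simp +contextual [div_eq_iff]
  have hcount := card_eq_sum_card_fiberwise hmaps
  rw [sum_congr rfl hfib, sum_const, smul_eq_mul, card_erase_of_mem (mem_univ _), card_univ,
    hσ.card_eq, ← one_pow 2, Nat.sq_sub_sq] at hcount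
  exact (Nat.eq_of_mul_eq_mul_right (by have := hσ.two_le; omega) hcount).symm

end IsQuadraticConj

/-- The binary quadratic form `N(x) - Tr(a x ^ 2)` over the fixed field of the involution `σ`. -/
def hermForm {F : Type*} [Field F] (σ : F →+* F) (a x : F) : F :=
  x * σ x - (a * x ^ 2 + σ (a * x ^ 2))

theorem hermForm_zero {F : Type*} [Field F] (σ : F →+* F) (a : F) : hermForm σ a 0 = 0 := by
  simp [hermForm]

/-- The condition that `hermForm σ a` is degenerate, that is, that the map `x ↦ σ x - 2 * a * x`
representing its polar form is not injective. -/
abbrev IsDegenerateHermForm {F : Type*} [Field F] (σ : F →+* F) (a : F) : Prop :=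
  2 * a * σ (2 * a) = 1

/-- The number of zeros of `N(x) - Tr(a x ^ 2 + b x) - t`: for `t = Tr(c)` these are the abscissas
of the points shared by the Hermitian curve and the parabola `y = a x ^ 2 + b x + c`. -/
def levelCard {F : Type*} [Field F] [Fintype F] [DecidableEq F] (σ : F →+* F) (a b t : F) : ℕ :=
  #{x | hermForm σ a x - (x * b + σ (x * b)) = t}

/-- The number of `t` in the fixed field of `σ` at which the level set counted by
`levelCard σ a b t` has `k` elements. -/
def levelFreq {F : Type*} [Field F] [Fintype F] [DecidableEq F] (σ : F →+* F) (a b : F) (k : ℕ) :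
    ℕ :=
  #{t | σ t = t ∧ levelCard σ a b t = k}

theorem levelCard_zero {F : Type*} [Field F] [Fintype F] [DecidableEq F] (σ : F →+* F) (a t : F) :
    levelCard σ a 0 t = #{x | hermForm σ a x = t} := by
  simp [levelCard]

namespace IsQuadraticConj

variable {q : ℕ} {F : Type*} [Field F] [Fintype F] {σ : F →+* F} {a b t : F}

theorem map_hermForm (hσ : IsQuadraticConj q σ) (a x : F) :
    σ (hermForm σ a x) = hermForm σ a x := by
  simp only [hermForm, map_sub, map_add, map_mul, map_pow, hσ.apply_apply]
  ring

theorem hermForm_add (hσ : IsQuadraticConj q σ) (a x y : F) :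
    hermForm σ a (x + y) = hermForm σ a x + hermForm σ a y +
      (x * (σ y - 2 * a * y) + σ (x * (σ y - 2 * a * y))) := by
  simp only [hermForm, map_sub, map_add, map_mul, map_pow, map_ofNat, hσ.apply_apply]
  ring

theorem exists_sub_mul_eq (hσ : IsQuadraticConj q σ) {u : F} (hu : u * σ u ≠ 1) (z : F) :
    ∃ x, σ x - u * x = z := by
  have hu' : 1 - u * σ u ≠ 0 := sub_ne_zero.2 hu.symm
  refine ⟨(σ z + σ u * z) / (1 - u * σ u), ?_⟩
  rw [map_div₀, map_sub, map_one, map_mul, map_add, map_mul, hσ.apply_apply, hσ.apply_apply,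
    mul_comm (σ u) u]
  field_simp
  ring

theorem eq_zero_of_eq_mul (hσ : IsQuadraticConj q σ) {u x : F} (hu : u * σ u ≠ 1)
    (hx : σ x = u * x) : x = 0 := by
  have hx' : x = σ u * (u * x) := by rw [← hx, ← map_mul, ← hx, hσ.apply_apply]
  exact (mul_eq_zero.1 (by linear_combination -hx' : (u * σ u - 1) * x = 0)).resolve_left
    (sub_ne_zero.2 hu)

/-- The hypotheses say that the line `σ x = u * x` is isotropic. -/
theorem hermForm_eq_mul (hσ : IsQuadraticConj q σ) {u : F} (hu : u * σ u = 1)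
    (htr : a * σ u + σ (a * σ u) = 1) (x : F) :
    hermForm σ a x = (σ x - u * x) * (a * σ u * x - σ a * σ x) := by
  simp only [map_mul, hσ.apply_apply] at htr
  simp only [hermForm, map_mul, map_pow]
  linear_combination -x * σ x * htr + a * x ^ 2 * hu

theorem hermForm_eq_neg_sq_of_isDegenerate (hσ : IsQuadraticConj q σ)
    (ha : IsDegenerateHermForm σ a) (x : F) :
    hermForm σ a x = -σ a * (σ x - 2 * a * x) ^ 2 := by
  rw [IsDegenerateHermForm, map_mul, map_ofNat] at ha
  rw [hσ.hermForm_eq_mul (u := 2 * a)] <;> simp only [map_mul, map_ofNat, hσ.apply_apply]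
  · ring
  · exact ha
  · linear_combination ha

variable [DecidableEq F]

theorem levelCard_sub_mul (hσ : IsQuadraticConj q σ) (a z t : F) :
    levelCard σ a (σ z - 2 * a * z) t = levelCard σ a 0 (t + hermForm σ a z) := by
  rw [levelCard_zero, levelCard]
  refine card_equiv (Equiv.subRight z) fun x ↦ ?_
  have hsquare : hermForm σ a x - (x * (σ z - 2 * a * z) + σ (x * (σ z - 2 * a * z))) =
      hermForm σ a (x - z) - hermForm σ a z := by
    simp only [hermForm, map_sub, map_mul, map_pow, map_ofNat, hσ.apply_apply]
    ring
  rw [mem_filter_univ, mem_filter_univ, hsquare, sub_eq_iff_eq_add, Equiv.subRight_apply]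

theorem levelFreq_sub_mul (hσ : IsQuadraticConj q σ) (a z : F) (k : ℕ) :
    levelFreq σ a (σ z - 2 * a * z) k = levelFreq σ a 0 k :=
  card_equiv (Equiv.addRight (hermForm σ a z)) fun t ↦ by
    simp [hσ.levelCard_sub_mul, hσ.map_hermForm]

theorem sum_levelCard_zero (hσ : IsQuadraticConj q σ) (a : F) :
    ∑ t with σ t = t, levelCard σ a 0 t = q ^ 2 := by
  simp only [levelCard_zero]
  rw [← card_eq_sum_card_fiberwise (s := univ) (fun x _ ↦ by simp [hσ.map_hermForm]), card_univ,
    hσ.card_eq]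

theorem sum_sq_levelCard_zero (hσ : IsQuadraticConj q σ) (ha : ¬IsDegenerateHermForm σ a) :
    ∑ t with σ t = t, levelCard σ a 0 t ^ 2 = q ^ 2 + (q ^ 2 - 1) * q := by
  have hd : ∀ d ∈ univ.erase 0, #{x | hermForm σ a (x + d) = hermForm σ a x} = q := by
    intro d hd
    rw [← hσ.card_trace_mul_eq (w := σ d - 2 * a * d) (t := -hermForm σ a d)
      (fun h ↦ (ne_of_mem_erase hd) (hσ.eq_zero_of_eq_mul ha (sub_eq_zero.1 h)))
      (by rw [map_neg, hσ.map_hermForm])]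
    refine congrArg card (filter_congr fun x _ ↦ ?_)
    rw [hσ.hermForm_add]
    constructor <;> intro h <;> linear_combination h
  simp only [levelCard_zero]
  calc ∑ t with σ t = t, #{x | hermForm σ a x = t} ^ 2
      = ∑ x, #{y | hermForm σ a y = hermForm σ a x} :=
        sum_sq_card_fiber fun x ↦ by simp [hσ.map_hermForm]
    _ = ∑ x, #{d | hermForm σ a (x + d) = hermForm σ a x} :=
        sum_congr rfl fun x _ ↦ (card_equiv (Equiv.addLeft x) (by simp)).symm
    _ = ∑ d, #{x | hermForm σ a (x + d) = hermForm σ a x} :=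
        sum_card_bipartiteAbove_eq_sum_card_bipartiteBelow _
    _ = q ^ 2 + (q ^ 2 - 1) * q := by
        rw [← add_sum_erase _ _ (mem_univ 0), sum_congr rfl hd]
        simp [hσ.card_eq]

/-- The level sets away from `0` have the mean and the mean square of a constant function. -/
theorem levelCard_zero_eq_of_not_isDegenerate (hσ : IsQuadraticConj q σ)
    (ha : ¬IsDegenerateHermForm σ a)
    {m : ℕ} (hm : levelCard σ a 0 0 = 1 ∧ m = q + 1 ∨ levelCard σ a 0 0 = 2 * q - 1 ∧ m = q - 1)
    (ht : σ t = t) (ht0 : t ≠ 0) : levelCard σ a 0 t = m := by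
  have hq := hσ.two_le
  have hcard : (#(({t | σ t = t} : Finset F).erase 0) : ℤ) = q - 1 := by
    rw [hσ.card_fixed_erase_zero, Nat.cast_pred (by omega)]
  have h0 : (0 : F) ∈ ({t | σ t = t} : Finset F) := by simp
  have hsum : (_ : ℤ) = _ := congrArg Nat.cast (hσ.sum_levelCard_zero a)
  have hsq : (_ : ℤ) = _ := congrArg Nat.cast (hσ.sum_sq_levelCard_zero ha)
  rw [← add_sum_erase _ _ h0] at hsum hsq
  push_cast [Nat.cast_pred (n := q ^ 2) (by positivity)] at hsum hsq
  have hvalues : (levelCard σ a 0 0 = (1 : ℤ) ∧ (m : ℤ) = q + 1) ∨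
      levelCard σ a 0 0 = (2 * q - 1 : ℤ) ∧ (m : ℤ) = q - 1 := by omega
  refine Nat.cast_injective <| eq_of_sum_eq_of_sum_sq_eq (R := ℤ)
    (T := ({t | σ t = t} : Finset F).erase 0) (M := fun t ↦ levelCard σ a 0 t) ?_ ?_ t (by simp [*])
  all_goals rw [hcard]
  · obtain ⟨h, hm⟩ | ⟨h, hm⟩ := hvalues <;> rw [h] at hsum <;> rw [hm] <;>
      linear_combination hsum
  · obtain ⟨h, hm⟩ | ⟨h, hm⟩ := hvalues <;> rw [h] at hsq <;> rw [hm] <;>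
      linear_combination hsq

theorem levelCard_zero_zero_of_isotropic (hσ : IsQuadraticConj q σ) (ha : ¬IsDegenerateHermForm σ a)
    {x : F} (hx0 : x ≠ 0) (hx : hermForm σ a x = 0) : levelCard σ a 0 0 = 2 * q - 1 := by
  have hσx0 : σ x ≠ 0 := (map_ne_zero σ).2 hx0
  obtain ⟨u, hu, htr⟩ : ∃ u, u * σ u = 1 ∧ a * σ u + σ (a * σ u) = 1 := by
    refine ⟨σ x / x, ?_, ?_⟩
    · rw [map_div₀, hσ.apply_apply]
      field_simp
    · simp only [hermForm, map_mul, map_pow] at hx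
      simp only [map_mul, map_div₀, hσ.apply_apply]
      field_simp
      linear_combination -hx
  have htr' : a * σ u + σ a * u = 1 := by rwa [map_mul, hσ.apply_apply] at htr
  have hσa : σ a ≠ 0 := by
    intro h
    simp [(map_eq_zero σ).1 h] at htr
  have hv : (a * σ u / σ a) * σ (a * σ u / σ a) = 1 := by
    rw [map_div₀, map_mul, hσ.apply_apply, hσ.apply_apply]
    have := (map_ne_zero σ).1 hσa
    field_simp
    linear_combination hu
  have huv : u ≠ a * σ u / σ a := by
    rw [ne_eq, eq_div_iff hσa]
    intro h
    have h2a : 2 * a = u := by linear_combination u * htr' - 2 * a * hu - u * h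
    exact ha (by rwa [IsDegenerateHermForm, h2a])
  rw [levelCard_zero, ← hσ.card_filter_eq_mul_or_eq_mul hu hv huv]
  refine congrArg card (filter_congr fun y _ ↦ ?_)
  rw [hσ.hermForm_eq_mul hu htr, mul_eq_zero, sub_eq_zero, sub_eq_zero, div_mul_eq_mul_div,
    eq_div_iff hσa, mul_comm (σ y), eq_comm (a := σ a * σ y)]

theorem levelCard_zero_zero_of_not_isDegenerate (hσ : IsQuadraticConj q σ)
    (ha : ¬IsDegenerateHermForm σ a) :
    levelCard σ a 0 0 = 1 ∨ levelCard σ a 0 0 = 2 * q - 1 := by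
  by_cases h : ∃ x ≠ 0, hermForm σ a x = 0
  · obtain ⟨x, hx0, hx⟩ := h
    exact .inr (hσ.levelCard_zero_zero_of_isotropic ha hx0 hx)
  · push Not at h
    refine .inl <| (levelCard_zero σ a 0).trans <| card_eq_one.2 ⟨0, ?_⟩
    ext x
    rw [mem_filter_univ, mem_singleton]
    exact ⟨not_imp_not.1 (h x), fun h ↦ h ▸ hermForm_zero σ a⟩

theorem levelFreq_zero_eq (σ : F →+* F) (a : F) (k : ℕ) :
    levelFreq σ a 0 k = (if levelCard σ a 0 0 = k then 1 else 0) +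
      #{t ∈ ({t | σ t = t} : Finset F).erase 0 | levelCard σ a 0 t = k} := by
  rw [levelFreq, ← filter_filter, ← insert_erase (by simp : 0 ∈ ({t | σ t = t} : Finset F)),
    filter_insert, erase_insert (by simp)]
  split_ifs
  · rw [card_insert_of_notMem (by simp), add_comm]
  · rw [zero_add]

theorem levelFreq_zero_eq_of_not_isDegenerate (hσ : IsQuadraticConj q σ)
    (ha : ¬IsDegenerateHermForm σ a)
    {m : ℕ} (hm : levelCard σ a 0 0 = 1 ∧ m = q + 1 ∨ levelCard σ a 0 0 = 2 * q - 1 ∧ m = q - 1)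
    (k : ℕ) : (levelFreq σ a 0 k : ℚ) =
      (if k = levelCard σ a 0 0 then 1 else 0) + (q - 1) * if k = m then 1 else 0 := by
  have hconst : ∀ t ∈ ({t | σ t = t} : Finset F).erase 0, levelCard σ a 0 t = k ↔ k = m := by
    intro t ht
    rw [mem_erase, mem_filter_univ] at ht
    rw [hσ.levelCard_zero_eq_of_not_isDegenerate ha hm ht.2 ht.1, eq_comm]
  rw [levelFreq_zero_eq, filter_congr hconst, filter_const, apply_ite card,
    hσ.card_fixed_erase_zero, card_empty]
  push_cast [Nat.cast_pred (by linarith [hσ.two_le] : 0 < q)]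
  rw [mul_boole]
  simp only [eq_comm]

theorem sum_levelFreq_of_not_isDegenerate (hσ : IsQuadraticConj q σ)
    (ha : ¬IsDegenerateHermForm σ a) {n m : ℕ}
    (hn : levelCard σ a 0 0 = n) (hm : n = 1 ∧ m = q + 1 ∨ n = 2 * q - 1 ∧ m = q - 1) (k : ℕ) :
    (∑ b, levelFreq σ a b k : ℚ) =
      q ^ 2 * ((if k = n then 1 else 0) + (q - 1) * if k = m then 1 else 0) := by
  have hconst (b : F) : levelFreq σ a b k = levelFreq σ a 0 k := by
    obtain ⟨z, rfl⟩ := hσ.exists_sub_mul_eq ha b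
    exact hσ.levelFreq_sub_mul a z k
  subst hn
  simp only [hconst, hσ.levelFreq_zero_eq_of_not_isDegenerate ha hm, sum_const, card_univ,
    hσ.card_eq, nsmul_eq_mul, Nat.cast_pow]

theorem levelCard_zero_zero_of_isDegenerate (hσ : IsQuadraticConj q σ)
    (ha : IsDegenerateHermForm σ a) :
    levelCard σ a 0 0 = q := by
  have hσa : σ a ≠ 0 := by
    intro h
    simp [IsDegenerateHermForm, h] at ha
  rw [levelCard_zero, ← hσ.card_filter_eq_mul ha]
  simp [hσ.hermForm_eq_neg_sq_of_isDegenerate ha, hσa, sub_eq_zero]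

theorem levelCard_zero_eq_or_eq_of_isDegenerate (hσ : IsQuadraticConj q σ)
    (ha : IsDegenerateHermForm σ a)
    (ht : t ≠ 0) : levelCard σ a 0 t = 0 ∨ levelCard σ a 0 t = 2 * q := by
  rw [levelCard_zero]
  obtain h | ⟨x, hx⟩ := ({x | hermForm σ a x = t} : Finset F).eq_empty_or_nonempty
  · exact .inl (card_eq_zero.2 h)
  right
  rw [mem_filter_univ] at hx
  subst hx
  set z := σ x - 2 * a * x with hz
  have h2 : (2 : F) ≠ 0 := by
    intro h
    simp [IsDegenerateHermForm, h] at ha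
  rw [hσ.hermForm_eq_neg_sq_of_isDegenerate ha] at ht
  obtain ⟨hσa, hz0⟩ : -σ a ≠ 0 ∧ z ≠ 0 := by simpa [hz] using ht
  have hσz : σ z = -σ (2 * a) * z := by
    rw [hz, map_sub, map_mul, hσ.apply_apply]
    linear_combination -x * ha
  have hor (y : F) : hermForm σ a y = hermForm σ a x ↔
      σ y - 2 * a * y = z ∨ σ y - 2 * a * y = -z := by
    rw [hσ.hermForm_eq_neg_sq_of_isDegenerate ha, hσ.hermForm_eq_neg_sq_of_isDegenerate ha,
      mul_right_inj' hσa, ← hz, sq_eq_sq_iff_eq_or_eq_neg]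
  have hdisj : Disjoint ({y | σ y - 2 * a * y = z} : Finset F)
      ({y | σ y - 2 * a * y = -z} : Finset F) := by
    refine disjoint_filter.2 fun y _ h h' ↦ mul_ne_zero h2 hz0 ?_
    linear_combination h' - h
  simp only [hor]
  rw [filter_or, card_union_of_disjoint hdisj, hσ.card_filter_sub_mul_eq ha hσz,
    hσ.card_filter_sub_mul_eq ha (by rw [map_neg, hσz, mul_neg]), two_mul]

theorem levelFreq_zero_eq_of_isDegenerate (hσ : IsQuadraticConj q σ)
    (ha : IsDegenerateHermForm σ a) (k : ℕ) :
    (levelFreq σ a 0 k : ℚ) = (if k = q then 1 else 0) +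
      (q - 1) / 2 * ((if k = 0 then 1 else 0) + if k = 2 * q then 1 else 0) := by
  have hq := hσ.two_le
  have hq0 : (q : ℚ) ≠ 0 := by positivity
  have hsum : (_ : ℚ) = _ := congrArg Nat.cast (hσ.sum_levelCard_zero a)
  rw [← add_sum_erase _ _ (by simp : 0 ∈ ({t | σ t = t} : Finset F)),
    hσ.levelCard_zero_zero_of_isDegenerate ha] at hsum
  push_cast at hsum
  rw [levelFreq_zero_eq, hσ.levelCard_zero_zero_of_isDegenerate ha, Nat.cast_add,
    card_filter_eq_of_eq_zero_or_eq (n := 2 * q) (by omega)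
      (fun t ht ↦ hσ.levelCard_zero_eq_or_eq_of_isDegenerate ha (ne_of_mem_erase ht)),
    eq_sub_of_add_eq' hsum, hσ.card_fixed_erase_zero, Nat.cast_pred (by omega)]
  push_cast
  have hhalf : ((q : ℚ) ^ 2 - q) / (2 * q) = (q - 1) / 2 := by field_simp
  rw [hhalf]
  simp only [eq_comm (a := q)]
  split_ifs <;> ring

/-- Here `x ↦ σ x - 2 * a * x` is injective on each level set, with values in a set of `q`
elements. -/
theorem levelCard_eq_of_isDegenerate (hσ : IsQuadraticConj q σ) (ha : IsDegenerateHermForm σ a)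
    (hb : σ b ≠ -σ (2 * a) * b) (ht : σ t = t) : levelCard σ a b t = q := by
  have hb' : b + 2 * a * σ b ≠ 0 := by
    intro h
    exact hb (by linear_combination σ (2 * a) * h - σ b * ha)
  have hu : -σ (2 * a) * σ (-σ (2 * a)) = 1 := by
    simpa [IsDegenerateHermForm, hσ.apply_apply, mul_comm] using ha
  have hle : ∀ t ∈ ({t | σ t = t} : Finset F), levelCard σ a b t ≤ q := by
    intro t _
    rw [← hσ.card_filter_eq_mul (u := -σ (2 * a)) hu]
    refine card_le_card_of_injOn (fun x ↦ σ x - 2 * a * x) (fun x _ ↦ ?_) fun x hx y hy hxy ↦ ?_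
    · simp only [coe_filter, mem_univ, true_and, Set.mem_ofPred_eq, map_sub, map_mul (f := σ) _ x,
        hσ.apply_apply]
      linear_combination -x * ha
    · simp only [coe_filter, mem_univ, true_and, Set.mem_ofPred_eq, map_mul,
        hσ.hermForm_eq_neg_sq_of_isDegenerate ha] at hx hy hxy
      rw [hxy] at hx
      refine sub_eq_zero.1 ((mul_eq_zero.1 ?_).resolve_right hb')
      linear_combination hy - hx - σ b * hxy
  refine card_fiber_eq_of_card_fiber_le (S := univ) (fun x _ ↦ ?_) hle ?_ t (by simpa using ht)
  · simp [hσ.map_hermForm, hσ.apply_apply, add_comm]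
  · rw [hσ.card_fixed, card_univ, hσ.card_eq, sq]

theorem sum_levelFreq_of_isDegenerate (hσ : IsQuadraticConj q σ)
    (ha : IsDegenerateHermForm σ a) (k : ℕ) :
    (∑ b, levelFreq σ a b k : ℚ) = q * ((q ^ 2 - q + 1) * (if k = q then 1 else 0) +
      (q - 1) / 2 * ((if k = 0 then 1 else 0) + if k = 2 * q then 1 else 0)) := by
  have hu : -σ (2 * a) * σ (-σ (2 * a)) = 1 := by
    simpa [IsDegenerateHermForm, hσ.apply_apply, mul_comm] using ha
  have hin : ∀ b ∈ ({b | σ b = -σ (2 * a) * b} : Finset F),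
      (levelFreq σ a b k : ℚ) = levelFreq σ a 0 k := by
    intro b hb
    have hne : ({z | σ z - 2 * a * z = b} : Finset F).Nonempty := by
      rw [← card_pos, hσ.card_filter_sub_mul_eq ha (by simpa using hb)]
      exact two_pos.trans_le hσ.two_le
    obtain ⟨z, hz⟩ := hne
    rw [← (mem_filter.1 hz).2, hσ.levelFreq_sub_mul]
  have hout : ∀ b ∈ ({b | ¬σ b = -σ (2 * a) * b} : Finset F),
      (levelFreq σ a b k : ℚ) = q * if k = q then 1 else 0 := by
    intro b hb
    have hconst : ∀ t : F, σ t = t ∧ levelCard σ a b t = k ↔ k = q ∧ σ t = t := fun t ↦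
      ⟨fun h ↦ ⟨h.2.symm.trans (hσ.levelCard_eq_of_isDegenerate ha (by simpa using hb) h.1), h.1⟩,
        fun h ↦ ⟨h.2, (hσ.levelCard_eq_of_isDegenerate ha (by simpa using hb) h.2).trans h.1.symm⟩⟩
    simp only [levelFreq, hconst]
    by_cases hk : k = q <;> simp [hk, hσ.card_fixed]
  have hcompl := card_filter_add_card_filter_not (s := univ) fun b ↦ σ b = -σ (2 * a) * b
  rw [hσ.card_filter_eq_mul hu, card_univ, hσ.card_eq, ← @Nat.cast_inj ℚ] at hcompl
  push_cast at hcompl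
  rw [← sum_filter_add_sum_filter_not _ fun b ↦ σ b = -σ (2 * a) * b, sum_congr rfl hin,
    sum_congr rfl hout, sum_const, sum_const, hσ.card_filter_eq_mul hu, nsmul_eq_mul, nsmul_eq_mul,
    eq_sub_of_add_eq' hcompl, hσ.levelFreq_zero_eq_of_isDegenerate ha]
  ring

theorem sum_levelCard_zero_zero (hσ : IsQuadraticConj q σ) :
    ∑ a, levelCard σ a 0 0 = q ^ 2 + (q ^ 2 - 1) * q := by
  have hcard : ∀ x ∈ univ.erase 0, #{a | hermForm σ a x = 0} = q := by
    intro x hx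
    rw [← hσ.card_trace_mul_eq (w := x ^ 2) (t := x * σ x)
      (pow_ne_zero 2 (ne_of_mem_erase hx)) (by rw [map_mul, hσ.apply_apply, mul_comm])]
    simp only [hermForm, sub_eq_zero, eq_comm (a := x * σ x)]
  simp only [levelCard_zero]
  calc ∑ a, #{x | hermForm σ a x = 0}
      = ∑ x, #{a | hermForm σ a x = 0} := sum_card_bipartiteAbove_eq_sum_card_bipartiteBelow _
    _ = q ^ 2 + (q ^ 2 - 1) * q := by
        rw [← add_sum_erase _ _ (mem_univ 0), sum_congr rfl hcard]
        simp [hermForm_zero, hσ.card_eq]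

theorem sum_eq_of_const_on_form_types (hσ : IsQuadraticConj q σ) {f : F → ℚ} {e h d : ℚ}
    (he : ∀ a, ¬IsDegenerateHermForm σ a → levelCard σ a 0 0 = 1 → f a = e)
    (hh : ∀ a, ¬IsDegenerateHermForm σ a → levelCard σ a 0 0 = 2 * q - 1 → f a = h)
    (hd : ∀ a, IsDegenerateHermForm σ a → f a = d) :
    ∑ a, f a = (q ^ 2 - q - #{a | IsDegenerateHermForm σ a}) / 2 * e +
      (q ^ 2 + q - #{a | IsDegenerateHermForm σ a}) / 2 * h +
      #{a | IsDegenerateHermForm σ a} * d := by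
  have hq := hσ.two_le
  have hq1 : (q - 1 : ℚ) ≠ 0 := sub_ne_zero.2 (by exact_mod_cast (by omega : q ≠ 1))
  -- `levelCard σ a 0 0` is `1`, `2 * q - 1` or `q`, the mean of the other two values.
  have hinterp (a : F) : f a = e + (h - e) * ((levelCard σ a 0 0 - 1) / (2 * (q - 1))) +
      (d - (e + h) / 2) * if IsDegenerateHermForm σ a then 1 else 0 := by
    by_cases ha : IsDegenerateHermForm σ a
    · rw [hd a ha, if_pos ha, hσ.levelCard_zero_zero_of_isDegenerate ha]
      field_simp
      ring
    · obtain h' | h' := hσ.levelCard_zero_zero_of_not_isDegenerate ha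
      · rw [he a ha h', if_neg ha, h', Nat.cast_one]
        ring
      · rw [hh a ha h', if_neg ha, h', Nat.cast_pred (by omega)]
        push_cast
        field_simp
        ring
  have hsum : (_ : ℚ) = _ := congrArg Nat.cast hσ.sum_levelCard_zero_zero
  push_cast [Nat.cast_pred (n := q ^ 2) (by positivity)] at hsum
  rw [sum_congr rfl fun a _ ↦ hinterp a]
  simp only [sum_add_distrib, ← mul_sum, ← sum_div, sum_sub_distrib, hsum, sum_boole, sum_const,
    card_univ, hσ.card_eq, nsmul_eq_mul]
  push_cast
  field_simp
  ring

theorem sum_erase_zero_sum_levelFreq (hσ : IsQuadraticConj q σ) (k : ℕ) :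
    (∑ a ∈ univ.erase 0, ∑ b, levelFreq σ a b k : ℚ) =
      ((q + 1) * (q - 2) - #{a | IsDegenerateHermForm σ a}) / 2 *
        (q ^ 2 * ((if k = 1 then 1 else 0) + (q - 1) * if k = q + 1 then 1 else 0)) +
      ((q + 1) * q - #{a | IsDegenerateHermForm σ a}) / 2 *
        (q ^ 2 * ((if k = 2 * q - 1 then 1 else 0) + (q - 1) * if k = q - 1 then 1 else 0)) +
      #{a | IsDegenerateHermForm σ a} * (q * ((q ^ 2 - q + 1) * (if k = q then 1 else 0) +
        (q - 1) / 2 * ((if k = 0 then 1 else 0) + if k = 2 * q then 1 else 0))) := by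
  have htotal := hσ.sum_eq_of_const_on_form_types
    (fun a ha hn ↦ hσ.sum_levelFreq_of_not_isDegenerate ha hn (.inl ⟨rfl, rfl⟩) k)
    (fun a ha hn ↦ hσ.sum_levelFreq_of_not_isDegenerate ha hn (.inr ⟨rfl, rfl⟩) k)
    (fun a ha ↦ hσ.sum_levelFreq_of_isDegenerate ha k)
  have hzero : levelCard σ 0 0 0 = 1 := by simp [levelCard_zero, hermForm, filter_eq']
  rw [← add_sum_erase _ _ (mem_univ 0),
    hσ.sum_levelFreq_of_not_isDegenerate (by simp) hzero (.inl ⟨rfl, rfl⟩)] at htotal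
  linear_combination htotal

theorem card_isDegenerateHermForm (hσ : IsQuadraticConj q σ) (h2 : (2 : F) ≠ 0) :
    #{a | IsDegenerateHermForm σ a} = q + 1 :=
  (card_equiv (Equiv.mulLeft₀ 2 h2) fun a ↦ by simp [IsDegenerateHermForm]).trans
    hσ.card_norm_eq_one

end IsQuadraticConj

section Parabolas

variable {q : ℕ} {F : Type*} [Field F]

theorem parabola_injective (hF : 2 < Nat.card F) :
    Function.Injective fun p : F × F × F ↦ parabola p.1 p.2.1 p.2.2 := by
  rintro ⟨a, b, c⟩ ⟨a', b', c'⟩ h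
  have hx (x : F) : a * x ^ 2 + b * x + c = a' * x ^ 2 + b' * x + c' :=
    (Set.ext_iff.1 h (x, a * x ^ 2 + b * x + c)).1 rfl
  obtain ⟨x, -, hx01⟩ := Set.exists_mem_notMem_of_ncard_lt_ncard
    (((Set.ncard_pair zero_ne_one).trans_lt hF).trans_eq (Set.ncard_univ F).symm)
  obtain ⟨hx0, hx1⟩ : x ≠ 0 ∧ x ≠ 1 := by simpa using hx01
  have hc : c = c' := by simpa using hx 0
  have ha : x * (x - 1) * (a - a') = 0 := by
    linear_combination hx x - x * hx 1 + (x - 1) * hc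
  obtain rfl : a = a' := by simpa [hx0, sub_eq_zero, hx1] using ha
  obtain rfl : b = b' := by linear_combination hx 1 - hc
  rw [hc]

theorem planarIntersection_mem_of_numParabolas_eq_zero [Finite F]
    {s : Set ℕ} (hs : ∀ k ∉ s, (numParabolas q F k : ℚ) = 0) {C : Set (F × F)}
    (hC : IsParabola C) : planarIntersection (hermitianCurve q F) C ∈ s := by
  by_contra h
  have hne : numParabolas q F (planarIntersection (hermitianCurve q F) C) ≠ 0 :=
    Set.ncard_ne_zero_of_mem (a := C) ⟨hC, rfl⟩
  exact hne (Nat.cast_eq_zero.1 (hs _ h))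

namespace IsQuadraticConj

variable [Fintype F] {σ : F →+* F}

theorem planarIntersection_parabola [DecidableEq F] (hσ : IsQuadraticConj q σ)
    (a b c : F) :
    planarIntersection (hermitianCurve q F) (parabola a b c) = levelCard σ a b (c + σ c) := by
  have himage : hermitianCurve q F ∩ parabola a b c = (fun x ↦ (x, a * x ^ 2 + b * x + c)) ''
      ({x | hermForm σ a x - (x * b + σ (x * b)) = c + σ c} : Finset F) := by
    ext ⟨x, y⟩
    simp only [hermitianCurve, parabola, hermForm, Set.mem_inter_iff, Set.mem_ofPred_eq,
      coe_filter, mem_univ, true_and, Set.mem_image, Prod.mk.injEq, pow_succ', ← hσ.apply_eq_pow]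
    constructor
    · rintro ⟨h, rfl⟩
      refine ⟨x, ?_, rfl, rfl⟩
      simp only [map_add, map_mul, map_pow] at h ⊢
      linear_combination h
    · rintro ⟨x, h, rfl, rfl⟩
      refine ⟨?_, rfl⟩
      simp only [map_add, map_mul, map_pow] at h ⊢
      linear_combination h
  rw [planarIntersection, himage,
    Set.ncard_image_of_injective _ (fun x y h ↦ congrArg Prod.fst h), Set.ncard_coe_finset,
    levelCard]

theorem card_filter_levelCard_trace [DecidableEq F] (hσ : IsQuadraticConj q σ) (a b : F)
    (k : ℕ) : #{c | levelCard σ a b (c + σ c) = k} = q * levelFreq σ a b k := by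
  have hfib : ∀ t ∈ ({t | σ t = t ∧ levelCard σ a b t = k} : Finset F),
      #{c ∈ ({c | levelCard σ a b (c + σ c) = k} : Finset F) | c + σ c = t} = q := by
    intro t ht
    rw [mem_filter_univ] at ht
    rw [filter_filter, ← hσ.card_trace_mul_eq one_ne_zero ht.1]
    simp only [mul_one]
    exact congrArg card (filter_congr fun c _ ↦ and_iff_right_of_imp fun h ↦ h ▸ ht.2)
  rw [card_eq_sum_card_fiberwise (f := fun c ↦ c + σ c)
    (t := {t | σ t = t ∧ levelCard σ a b t = k}) (fun c hc ↦ ?_), sum_congr rfl hfib, sum_const,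
    smul_eq_mul, mul_comm, levelFreq]
  simpa [hσ.apply_apply, add_comm] using hc

theorem numParabolas_eq [DecidableEq F] (hσ : IsQuadraticConj q σ) (k : ℕ) :
    numParabolas q F k = q * ∑ a ∈ univ.erase 0, ∑ b : F, levelFreq σ a b k := by
  have himage :
      {C : Set (F × F) | IsParabola C ∧ planarIntersection (hermitianCurve q F) C = k} =
      (fun p : F × F × F ↦ parabola p.1 p.2.1 p.2.2) ''
        ({p | p.1 ≠ 0 ∧ levelCard σ p.1 p.2.1 (p.2.2 + σ p.2.2) = k} : Finset (F × F × F)) := by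
    ext C
    simp only [IsParabola, Set.mem_ofPred_eq, coe_filter, mem_univ, true_and, Set.mem_image,
      Prod.exists]
    constructor
    · rintro ⟨⟨a, b, c, ha, rfl⟩, h⟩
      exact ⟨a, b, c, ⟨ha, hσ.planarIntersection_parabola a b c ▸ h⟩, rfl⟩
    · rintro ⟨a, b, c, ⟨ha, h⟩, rfl⟩
      exact ⟨⟨a, b, c, ha, rfl⟩, (hσ.planarIntersection_parabola a b c).trans h⟩
  have hF : 2 < Nat.card F := by
    rw [Nat.card_eq_fintype_card, hσ.card_eq]
    nlinarith [hσ.two_le]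
  rw [numParabolas, himage, Set.ncard_image_of_injective _ (parabola_injective hF),
    Set.ncard_coe_finset, card_filter, Fintype.sum_prod_type, ← add_sum_erase _ _ (mem_univ 0),
    mul_sum]
  simp only [ne_eq, not_true_eq_false, false_and, if_false, sum_const_zero, zero_add]
  refine sum_congr rfl fun a ha ↦ ?_
  rw [Fintype.sum_prod_type, mul_sum]
  simp only [ne_of_mem_erase ha, not_false_eq_true, true_and, ← card_filter,
    hσ.card_filter_levelCard_trace]

theorem numParabolas_of_odd (hσ : IsQuadraticConj q σ) (hq : Odd q) (k : ℕ) :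
    (numParabolas q F k : ℚ) = q ^ 2 * (q + 1) * (
      (q - 1) / 2 * (if k = 0 then 1 else 0) + q * (q - 3) / 2 * (if k = 1 then 1 else 0) +
      q * (q - 1) ^ 2 / 2 * (if k = q - 1 then 1 else 0) +
      (q ^ 2 - q + 1) * (if k = q then 1 else 0) +
      q * (q - 1) * (q - 3) / 2 * (if k = q + 1 then 1 else 0) +
      q * (q - 1) / 2 * (if k = 2 * q - 1 then 1 else 0) +
      (q - 1) / 2 * (if k = 2 * q then 1 else 0)) := by
  classical
  rw [hσ.numParabolas_eq]
  push_cast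
  rw [hσ.sum_erase_zero_sum_levelFreq, hσ.card_isDegenerateHermForm
    (hσ.two_eq_zero_iff.not.2 (Nat.not_even_iff_odd.2 hq))]
  push_cast
  ring

theorem numParabolas_of_even (hσ : IsQuadraticConj q σ) (hq : Even q) (k : ℕ) :
    (numParabolas q F k : ℚ) = q ^ 3 * (q + 1) * (
      (q / 2 - 1) * (if k = 1 then 1 else 0) + (q - 1) * (q / 2) * (if k = q - 1 then 1 else 0) +
      (q - 1) * (q / 2 - 1) * (if k = q + 1 then 1 else 0) +
      q / 2 * (if k = 2 * q - 1 then 1 else 0)) := by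
  classical
  rw [hσ.numParabolas_eq]
  push_cast
  rw [hσ.sum_erase_zero_sum_levelFreq]
  simp only [IsDegenerateHermForm, hσ.two_eq_zero_iff.2 hq, zero_mul, zero_ne_one, filter_false,
    card_empty, Nat.cast_zero]
  ring

end IsQuadraticConj

end Parabolas

theorem theorem3p1 (q : ℕ) (hq : IsPrimePow q) (F : Type*) [Field F] [Finite F]
    (hF : Nat.card F = q ^ 2) :
    (Odd q →
      (∀ C : Set (F × F), IsParabola C →
        planarIntersection (hermitianCurve q F) C ∈
          ({0, 1, q - 1, q, q + 1, 2 * q - 1, 2 * q} : Set ℕ)) ∧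
      (numParabolas q F 0 : ℚ) = q ^ 2 * (q + 1) * ((q - 1) / 2) ∧
      (numParabolas q F 1 : ℚ) = q ^ 2 * (q + 1) * (q * (q - 3) / 2) ∧
      (numParabolas q F (q - 1) : ℚ) = q ^ 2 * (q + 1) * (q * (q - 1) ^ 2 / 2) ∧
      (numParabolas q F q : ℚ) = q ^ 2 * (q + 1) * (q ^ 2 - q + 1) ∧
      (numParabolas q F (q + 1) : ℚ) = q ^ 2 * (q + 1) * (q * (q - 1) * (q - 3) / 2) ∧
      (numParabolas q F (2 * q - 1) : ℚ) = q ^ 2 * (q + 1) * (q * (q - 1) / 2) ∧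
      (numParabolas q F (2 * q) : ℚ) = q ^ 2 * (q + 1) * ((q - 1) / 2)) ∧
    (Even q →
      (∀ C : Set (F × F), IsParabola C →
        planarIntersection (hermitianCurve q F) C ∈
          ({1, q - 1, q + 1, 2 * q - 1} : Set ℕ)) ∧
      (q ≠ 2 →
        (numParabolas q F 1 : ℚ) = q ^ 3 * (q + 1) * (q / 2 - 1) ∧
        (numParabolas q F (q - 1) : ℚ) = q ^ 3 * (q + 1) * (q - 1) * (q / 2) ∧
        (numParabolas q F (q + 1) : ℚ) = q ^ 3 * (q + 1) * (q - 1) * (q / 2 - 1) ∧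
        (numParabolas q F (2 * q - 1) : ℚ) = q ^ 3 * (q + 1) * (q / 2)) ∧
      (q = 2 → numParabolas q F 1 = 24 ∧ numParabolas q F 3 = 24)) := by
  have := Fintype.ofFinite F
  obtain ⟨σ, hσ⟩ := exists_isQuadraticConj hq (Nat.card_eq_fintype_card.symm.trans hF)
  have hq2 := hσ.two_le
  refine ⟨fun hodd ↦ ⟨fun C hC ↦ ?_, ?_⟩, fun heven ↦ ⟨fun C hC ↦ ?_, fun hne ↦ ?_, ?_⟩⟩
  · refine planarIntersection_mem_of_numParabolas_eq_zero (fun k hk ↦ ?_) hC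
    simp only [Set.mem_insert_iff, Set.mem_singleton_iff, not_or] at hk
    simp [hσ.numParabolas_of_odd hodd, hk]
  · have hq3 : 3 ≤ q := by grind
    refine ⟨?_, ?_, ?_, ?_, ?_, ?_, ?_⟩ <;> rw [hσ.numParabolas_of_odd hodd] <;>
      simp (disch := omega) only [if_neg, if_true] <;> ring
  · refine planarIntersection_mem_of_numParabolas_eq_zero (fun k hk ↦ ?_) hC
    simp only [Set.mem_insert_iff, Set.mem_singleton_iff, not_or] at hk
    simp [hσ.numParabolas_of_even heven, hk]
  · have hq4 : 4 ≤ q := by grind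
    refine ⟨?_, ?_, ?_, ?_⟩ <;> rw [hσ.numParabolas_of_even heven] <;>
      simp (disch := omega) only [if_neg, if_true] <;> ring
  · rintro rfl
    constructor <;> rw [← @Nat.cast_inj ℚ, hσ.numParabolas_of_even heven] <;> norm_num
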